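/- **Setting.** Let $\mathcal N$ be a countably infinite set of names, each with a sort, such that every sort that occurs has infinitely many names. A permutation is a sort-preserving bijection of $\mathcal N$ that moves only finitely many names. For a set with an action of the group of permutations, a set $N$ of names supports $x$ if every permutation fixing $N$ pointwise fixes $x$; $\operatorname{supp}(x)$ is the least finite supporting set if a finite one exists; $x$ is then called finitely supported. A nominal set is a set with such an action all of whose elements are finitely supported. A finite set $N$ of names is fresh for $x$, $N\# x$, if $N\cap\operatorname{supp}(x)=\emptyset$. For finite $N\subseteq\mathcal N$, $\langle N\rangle x$ is the class of $(N,x)$ under alpha-equivalence: $(N,x)=_\alpha(N',x')$ iff some permutation $\pi$ satisfies $\pi\cdot N=N'$, $\pi\cdot x=x'$ and $\pi(a)=a$ for all $a\in\operatorname{supp}(x)\setminus N$. A *nominal transition system* consists of nominal sets of states $P,Q$, of state predicates $\varphi$ and of actions $\alpha$; an equivariant relation $P\vdash\varphi$; an equivariant function $\operatorname{bn}$ giving a finite set $\operatorname{bn}(\alpha)\subseteq\operatorname{supp}(\alpha)$ for every action $\alpha$; and an equivariant set of transitions $(P,\langle N\rangle(\alpha,P'))$, all of which satisfy $N=\operatorname{bn}(\alpha)$.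 Write $P\xrightarrow{\alpha}P'$ if $(P,\langle\operatorname{bn}(\alpha)\rangle(\alpha,P'))$ is a transition. A *bisimulation* is a symmetric relation $R$ on states such that $R(P,Q)$ implies: (1) $P\vdash\varphi$ implies $Q\vdash\varphi$, for every $\varphi$; (2) whenever $\operatorname{bn}(\alpha)\# Q$ and $P\xrightarrow{\alpha}P'$, there is $Q'$ with $Q\xrightarrow{\alpha}Q'$ and $R(P',Q')$. States $P,Q$ are *bisimilar*, $P\mathrel{\dot\sim}Q$, if some bisimulation relates them. Let $\kappa$ be a cardinal with $\kappa>\aleph_0$ and $\kappa>|\mathrm{States}|$. *Formulas* are defined inductively by $$A ::= \textstyle\bigwedge_{i\in I}A_i \mid \neg A\mid\varphi\mid\langle\alpha\rangle A,$$ where $\bigwedge_{i\in I}A_i$ is the conjunction of the set $\{A_i\mid i\in I\}$, which must be finitely supported and of cardinality less than $\kappa$, and where in $\langle\alpha\rangle A$ the names in $\operatorname{bn}(\alpha)$ are bound in $\alpha$ and $A$ (formulas are taken up to renaming of these). Permutations act through all constructors. Put $\bigvee_{i\in I}A_i:=\neg\bigwedge_{i\in I}\neg A_i$. Validity $P\models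 A$ is defined by recursion: $P\models\bigwedge_{i\in I}A_i$ iff $P\models A_i$ for all $i\in I$; $P\models\neg A$ iff not $P\models A$; $P\models\varphi$ iff $P\vdash\varphi$; and, for a representative with $\operatorname{bn}(\alpha)\# P$, $P\models\langle\alpha\rangle A$ iff $P'\models A$ for some $P'$ with $P\xrightarrow{\alpha}P'$. States $P,Q$ are *logically equivalent*, $P\mathrel{\dot=}Q$, if they satisfy the same formulas. A formula $A$ *distinguishes* $P$ from $Q$ if $P\models A$ and not $Q\models A$. **Theorem (Expressive Completeness).** For every finitely supported set $S$ of states that is closed under bisimilarity ($P\in S$ and $P\mathrel{\dot\sim}Q$ imply $Q\in S$) there is a formula $A$ such that, for all states $P$, $P\models A$ iff $P\in S$. More precisely: 1. There is a choice $B$ of formulas $B_{P,Q}$, for all states $P,Q$ that are not logically equivalent, such that $B_{P,Q}$ distinguishes $P$ from $Q$ and $\operatorname{supp}(B_{P,Q})\subseteq\operatorname{supp}(P)$. 2. For every such choice $B$, and all $P,Q$ that are not logically equivalent, $D(P,Q):=\bigwedge_\pi\pi^{-1}\cdot B_{\pi\cdot P,\pi\cdot Q}$ ($\pi$ ranging over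 all permutations) is a formula that distinguishes $P$ from $Q$, with $\operatorname{supp}(D(P,Q))\subseteq\operatorname{supp}(P)$; and $D$ is equivariant: $\pi\cdot D(P,Q)=D(\pi\cdot P,\pi\cdot Q)$. 3. For $D$ as in 2 and every state $P$, $\mathrm{Char}(P):=\bigwedge_{Q\,:\,P\not\mathrel{\dot=}Q}D(P,Q)$ is a formula, and it is characteristic for $P$: for all $Q$, $P\mathrel{\dot\sim}Q$ iff $Q\models\mathrm{Char}(P)$. Moreover $\mathrm{Char}$ is equivariant: $\pi\cdot\mathrm{Char}(P)=\mathrm{Char}(\pi\cdot P)$. 4. For $\mathrm{Char}$ as in 3 and every finitely supported set $S$ of states closed under bisimilarity, $\bigvee_{P'\in S}\mathrm{Char}(P')$ is a formula, and for all $P$: $P\models\bigvee_{P'\in S}\mathrm{Char}(P')$ iff $P\in S$. -/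

import Mathlib

open scoped Pointwise Cardinal

universe un us uS uP uA ux w

namespace NomHML

section Nominal

variable {𝒩 : Type un} {Srt : Type us}

/-- The permutations of names: sort-preserving bijections that move only finitely many names. -/
def NamePerm (srt : 𝒩 → Srt) : Subgroup (Equiv.Perm 𝒩) where
  carrier := {π | {a | π a ≠ a}.Finite ∧ ∀ a, srt (π a) = srt a}
  one_mem' := by simp
  mul_mem' := by
    rintro π ρ ⟨h1, h2⟩ ⟨h3, h4⟩
    refine ⟨(h1.union h3).subset ?_, fun a => ?_⟩
    · intro a ha
      by_contra hc
      have h1 : π a = a := by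
        by_contra h
        exact hc (Or.inl h)
      have h2 : ρ a = a := by
        by_contra h
        exact hc (Or.inr h)
      apply ha
      rw [Equiv.Perm.mul_apply, h2, h1]
    · rw [Equiv.Perm.mul_apply, h2, h4]
  inv_mem' := by
    rintro π ⟨h1, h2⟩
    refine ⟨h1.subset ?_, fun a => ?_⟩
    · intro a ha hc
      apply ha
      rw [Equiv.Perm.inv_eq_iff_eq]
      exact hc.symm
    · have h := h2 (π⁻¹ a)
      have h3 : π (π⁻¹ a) = a := Equiv.apply_symm_apply π a
      rw [h3] at h
      exact h.symm

variable (srt : 𝒩 → Srt) {X : Type ux} [MulAction (NamePerm srt) X]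

/-- `x` is supported by some finite set of names. -/
def FinSupp (x : X) : Prop :=
  ∃ N : Finset 𝒩, MulAction.Supports (NamePerm srt) (N : Set 𝒩) x

/-- The support of `x`: the least finite set of names that supports `x`, obtained as the
intersection of all of them. -/
def supp (x : X) : Set 𝒩 :=
  {a | ∀ N : Finset 𝒩, MulAction.Supports (NamePerm srt) (N : Set 𝒩) x → a ∈ N}

/-- The names in `N` are fresh for `x`. -/
def Fresh (N : Finset 𝒩) (x : X) : Prop := ∀ a ∈ N, a ∉ supp srt x

/-- The image of a finite set of names under a permutation. -/
def permNames {srt : 𝒩 → Srt} (π : NamePerm srt) (N : Finset 𝒩) : Finset 𝒩 :=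
  N.map (π : Equiv.Perm 𝒩).toEmbedding

variable {srt}

theorem mem_permNames {π : NamePerm srt} {N : Finset 𝒩} {a : 𝒩} :
    a ∈ permNames π N ↔ π⁻¹ • a ∈ N := by
  unfold permNames
  rw [Finset.mem_map_equiv]
  rfl

theorem permNames_one (N : Finset 𝒩) : permNames (1 : NamePerm srt) N = N := by
  ext a; simp [mem_permNames]

theorem permNames_mul (π ρ : NamePerm srt) (N : Finset 𝒩) :
    permNames (π * ρ) N = permNames π (permNames ρ N) := by
  ext a; simp only [mem_permNames, mul_inv_rev, mul_smul]

theorem supports_smul {N : Finset 𝒩} {x : X} (π : NamePerm srt)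
    (h : MulAction.Supports (NamePerm srt) (N : Set 𝒩) x) :
    MulAction.Supports (NamePerm srt) (permNames π N : Set 𝒩) (π • x) := by
  intro ρ hρ
  have h1 : (π⁻¹ * ρ * π) • x = x := by
    apply h
    intro a ha
    have h2 : ρ • (π • a) = π • a := by
      apply hρ
      rw [Finset.mem_coe, mem_permNames, inv_smul_smul]
      exact ha
    rw [mul_smul, mul_smul, h2, inv_smul_smul]
  rw [mul_smul, mul_smul, inv_smul_eq_iff] at h1
  exact h1

theorem mem_supp_smul {π : NamePerm srt} {x : X} {a : 𝒩} :
    a ∈ supp srt (π • x) ↔ π⁻¹ • a ∈ supp srt x := by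
  constructor
  · intro h N hN
    have := h _ (supports_smul π hN)
    rwa [mem_permNames] at this
  · intro h N hN
    have h1 := supports_smul π⁻¹ hN
    rw [inv_smul_smul] at h1
    have := h _ h1
    rwa [mem_permNames, inv_inv, smul_inv_smul] at this

theorem FinSupp.smul {x : X} (π : NamePerm srt) (h : FinSupp srt x) : FinSupp srt (π • x) := by
  obtain ⟨N, hN⟩ := h
  exact ⟨_, supports_smul π hN⟩

/-- The permutation that swaps two names of the same sort. -/
def nameSwap (srt : 𝒩 → Srt) [DecidableEq 𝒩] (a c : 𝒩) (h : srt c = srt a) : NamePerm srt :=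
  ⟨Equiv.swap a c, by
    refine ⟨(Set.toFinite {a, c}).subset ?_, fun b => ?_⟩
    · intro b hb
      by_contra hc
      simp only [Set.mem_insert_iff, Set.mem_singleton_iff, not_or] at hc
      exact hb (Equiv.swap_apply_of_ne_of_ne hc.1 hc.2)
    · rw [Equiv.swap_apply_def]
      split_ifs with h3 h4
      · rw [h3, h]
      · rw [h4, h]
      · rfl⟩

theorem nameSwap_smul [DecidableEq 𝒩] {a c : 𝒩} (h : srt c = srt a) (b : 𝒩) :
    nameSwap srt a c h • b = Equiv.swap a c b := rfl

/-- On a finite set of names, a permutation agrees with one that moves only names in that set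
and in its image. -/
theorem exists_perm_agree (π : NamePerm srt) (N : Finset 𝒩) :
    ∃ σ : NamePerm srt, (∀ a ∈ N, σ • a = π • a) ∧
      ∀ a, a ∉ N → a ∉ permNames π N → σ • a = a := by
  classical
  induction N using Finset.induction_on with
  | empty => exact ⟨1, by simp, fun a _ _ => one_smul _ a⟩
  | insert a N ha ih =>
    obtain ⟨σ, h1, h2⟩ := ih
    have hsrt : ∀ (ρ : NamePerm srt) (b : 𝒩), srt (ρ • b) = srt b := fun ρ b => ρ.2.2 b
    have hs : srt (σ⁻¹ • π • a) = srt a := by rw [hsrt, hsrt]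
    let τ : NamePerm srt := nameSwap srt a (σ⁻¹ • π • a) hs
    have hτ : ∀ b, τ • b = Equiv.swap a (σ⁻¹ • π • a) b := fun b => rfl
    refine ⟨σ * τ, ?_, ?_⟩
    · intro b hb
      rw [mul_smul, hτ]
      rcases Finset.mem_insert.1 hb with rfl | hb
      · rw [Equiv.swap_apply_left, smul_inv_smul]
      · rw [Equiv.swap_apply_of_ne_of_ne, h1 b hb]
        · exact fun hc => ha (hc ▸ hb)
        · intro hc
          have h3 := h1 b hb
          rw [hc, smul_inv_smul, ← hc] at h3
          exact ha (smul_left_cancel π h3 ▸ hb)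
    · intro b hb hb'
      rw [Finset.mem_insert, not_or] at hb
      rw [mem_permNames, Finset.mem_insert, not_or] at hb'
      have h3 : σ • b = b := h2 b hb.2 (by rw [mem_permNames]; exact hb'.2)
      rw [mul_smul, hτ, Equiv.swap_apply_of_ne_of_ne hb.1, h3]
      intro hc
      rw [hc, smul_inv_smul] at h3
      apply hb'.1
      rw [hc, ← h3, inv_smul_smul]

/-- Finitely many names can be renamed to names outside a given finite set. -/
theorem exists_perm_fresh (hsrt : ∀ a : 𝒩, {b | srt b = srt a}.Infinite) (K F : Finset 𝒩) :
    ∃ σ : NamePerm srt, (∀ a ∈ K, σ • a ∉ F) ∧ ∀ a ∈ F, a ∉ K → σ • a = a := by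
  classical
  induction K using Finset.induction_on with
  | empty => exact ⟨1, by simp, fun a _ _ => one_smul _ a⟩
  | insert a K ha ih =>
    obtain ⟨σ, h1, h2⟩ := ih
    obtain ⟨c, hc, hc'⟩ := (hsrt a).exists_notMem_finset (F ∪ insert a K ∪ permNames σ⁻¹ F)
    simp only [Finset.mem_union, not_or, mem_permNames, inv_inv] at hc'
    refine ⟨σ * nameSwap srt a c hc, ?_, ?_⟩
    · intro b hb
      rw [mul_smul, nameSwap_smul]
      rcases Finset.mem_insert.1 hb with rfl | hb'
      · rw [Equiv.swap_apply_left]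
        exact hc'.2
      · rw [Equiv.swap_apply_of_ne_of_ne]
        · exact h1 b hb'
        · exact fun h => ha (h ▸ hb')
        · exact fun h => hc'.1.2 (h ▸ hb)
    · intro b hb hb'
      rw [Finset.mem_insert, not_or] at hb'
      rw [mul_smul, nameSwap_smul, Equiv.swap_apply_of_ne_of_ne hb'.1, h2 b hb hb'.2]
      exact fun h => hc'.1.1 (h ▸ hb)

/-- A finitely supported object is supported by its support. -/
theorem FinSupp.supports_supp (hsrt : ∀ a : 𝒩, {b | srt b = srt a}.Infinite) {x : X}
    (h : FinSupp srt x) : MulAction.Supports (NamePerm srt) (supp srt x) x := by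
  classical
  have inter : ∀ N M : Finset 𝒩, MulAction.Supports (NamePerm srt) (N : Set 𝒩) x →
      MulAction.Supports (NamePerm srt) (M : Set 𝒩) x →
      MulAction.Supports (NamePerm srt) ((N ∩ M : Finset 𝒩) : Set 𝒩) x := by
    intro N M hN hM π hπ
    obtain ⟨σ, h1, h2⟩ := exists_perm_fresh hsrt (M \ N) (N ∪ π.2.1.toFinset)
    have h3 : σ • x = x := hN σ fun a ha => h2 a (by simp [Finset.mem_coe.1 ha])
      (by simp [Finset.mem_coe.1 ha])
    have h4 := supports_smul σ hM
    rw [h3] at h4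
    apply h4
    intro a ha
    rw [Finset.mem_coe, mem_permNames] at ha
    by_cases hN' : σ⁻¹ • a ∈ N
    · have h5 : σ • σ⁻¹ • a = σ⁻¹ • a := h2 _ (by simp [hN']) (by simp [hN'])
      rw [smul_inv_smul] at h5
      rw [← h5] at ha hN'
      exact hπ (by simp [ha, hN'])
    · have h5 := h1 (σ⁻¹ • a) (by simp [ha, hN'])
      rw [smul_inv_smul, Finset.mem_union, not_or, Set.Finite.mem_toFinset] at h5
      by_contra hc
      exact h5.2 hc
  obtain ⟨N, hN, hmin⟩ := WellFounded.has_min (measure (Finset.card (α := 𝒩))).wf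
    {N : Finset 𝒩 | MulAction.Supports (NamePerm srt) (N : Set 𝒩) x} h
  have h1 : (N : Set 𝒩) ⊆ supp srt x := by
    intro a ha M hM
    by_contra hc
    apply hmin _ (inter N M hN hM)
    exact Finset.card_lt_card ⟨Finset.inter_subset_left, fun h =>
      hc (Finset.mem_inter.1 (h (Finset.mem_coe.1 ha))).2⟩
  exact fun π hπ => hN π fun a ha => hπ (h1 ha)

variable (srt) (X)

/-- Nominal alpha-equivalence of pairs of a finite set of (bound) names and an object. -/
def absSetoid : Setoid (Finset 𝒩 × X) where
  r p q := ∃ π : NamePerm srt, permNames π p.1 = q.1 ∧ π • p.2 = q.2 ∧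
    ∀ a ∈ supp srt p.2 \ (p.1 : Set 𝒩), π • a = a
  iseqv :=
    { refl := fun p => ⟨1, permNames_one _, one_smul _ _, fun a _ => one_smul _ a⟩
      symm := by
        rintro ⟨N, x⟩ ⟨M, y⟩ ⟨π, rfl, rfl, h⟩
        refine ⟨π⁻¹, ?_, inv_smul_smul _ _, ?_⟩
        · rw [← permNames_mul, inv_mul_cancel, permNames_one]
        · rintro a ⟨ha, hb⟩
          have h1 := h (π⁻¹ • a) ⟨mem_supp_smul.1 ha, fun hc => hb (mem_permNames.2 hc)⟩
          rw [smul_inv_smul] at h1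
          exact h1.symm
      trans := by
        rintro ⟨N, x⟩ ⟨M, y⟩ ⟨L, z⟩ ⟨π, rfl, rfl, h⟩ ⟨ρ, rfl, rfl, h'⟩
        refine ⟨ρ * π, permNames_mul _ _ _, mul_smul _ _ _, ?_⟩
        rintro a ⟨ha, hb⟩
        have h1 := h a ⟨ha, hb⟩
        have h2 : π⁻¹ • a = a := by rw [inv_smul_eq_iff, h1]
        have h3 := h' a ⟨mem_supp_smul.2 (by rwa [h2]), fun hc => hb (by
          have := mem_permNames.1 hc
          rwa [h2] at this)⟩
        rw [mul_smul, h1, h3] }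

/-- Generalised name abstraction: finite sets of names paired with elements of `X`, modulo
nominal alpha-equivalence. -/
def NameAbs : Type (max un ux) := Quotient (absSetoid srt X)

variable {X}

/-- The name abstraction of `x` with bound names `N`. -/
def NameAbs.mk (N : Finset 𝒩) (x : X) : NameAbs srt X := Quotient.mk (absSetoid srt X) (N, x)

instance : SMul (NamePerm srt) (NameAbs srt X) where
  smul ρ := Quotient.map (sa := absSetoid srt X) (sb := absSetoid srt X)
    (fun p => (permNames ρ p.1, ρ • p.2)) (by
      rintro ⟨N, x⟩ ⟨M, y⟩ ⟨π, rfl, rfl, h⟩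
      refine ⟨ρ * π * ρ⁻¹, ?_, ?_, ?_⟩
      · rw [← permNames_mul, ← permNames_mul, inv_mul_cancel_right]
      · rw [smul_smul, smul_smul, inv_mul_cancel_right]
      · rintro a ⟨ha, hb⟩
        have h1 := h (ρ⁻¹ • a) ⟨mem_supp_smul.1 ha, fun hc => hb (mem_permNames.2 hc)⟩
        rw [mul_smul, mul_smul, h1, smul_inv_smul])

theorem NameAbs.smul_mk (π : NamePerm srt) (N : Finset 𝒩) (x : X) :
    π • NameAbs.mk srt N x = NameAbs.mk srt (permNames π N) (π • x) := rfl

end Nominal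

section NTS

variable {𝒩 : Type un} {Srt : Type us}

/-- Nominal transition systems. -/
structure NTS (srt : 𝒩 → Srt) (State : Type uS) (Pred : Type uP) (Act : Type uA)
    [MulAction (NamePerm srt) State] [MulAction (NamePerm srt) Pred]
    [MulAction (NamePerm srt) Act] where
  state_finSupp : ∀ P : State, FinSupp srt P
  pred_finSupp : ∀ φ : Pred, FinSupp srt φ
  act_finSupp : ∀ α : Act, FinSupp srt α
  /-- In a state a state predicate holds. -/
  holds : State → Pred → Prop
  holds_equivariant : ∀ (π : NamePerm srt) (P : State) (φ : Pred),
    holds (π • P) (π • φ) ↔ holds P φ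
  /-- The binding names of an action. -/
  bn : Act → Finset 𝒩
  bn_equivariant : ∀ (π : NamePerm srt) (α : Act), bn (π • α) = permNames π (bn α)
  bn_subset_supp : ∀ α : Act, (bn α : Set 𝒩) ⊆ supp srt α
  /-- The transition relation, between states and residuals. -/
  trans : Set (State × NameAbs srt (Act × State))
  trans_equivariant : ∀ (π : NamePerm srt) (P : State) (r : NameAbs srt (Act × State)),
    (π • P, π • r) ∈ trans ↔ (P, r) ∈ trans
  trans_bn : ∀ (P : State) (N : Finset 𝒩) (α : Act) (Q : State),
    (P, NameAbs.mk srt N (α, Q)) ∈ trans → bn α = N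

variable {srt : 𝒩 → Srt} {State : Type uS} {Pred : Type uP} {Act : Type uA}
  [MulAction (NamePerm srt) State] [MulAction (NamePerm srt) Pred]
  [MulAction (NamePerm srt) Act] (T : NTS srt State Pred Act)

/-- The transition from `P` to `P'` with action `α`. -/
def NTS.Step (P : State) (α : Act) (P' : State) : Prop :=
  (P, NameAbs.mk srt (T.bn α) (α, P')) ∈ T.trans

theorem NTS.step_smul (π : NamePerm srt) (P : State) (α : Act) (P' : State) :
    T.Step (π • P) (π • α) (π • P') ↔ T.Step P α P' := by
  unfold NTS.Step
  rw [T.bn_equivariant]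
  exact T.trans_equivariant π P (NameAbs.mk srt (T.bn α) (α, P'))

/-- Bisimulations. -/
structure NTS.IsBisimulation (R : State → State → Prop) : Prop where
  symm : ∀ P Q, R P Q → R Q P
  static : ∀ P Q, R P Q → ∀ φ : Pred, T.holds P φ → T.holds Q φ
  sim : ∀ P Q, R P Q → ∀ (α : Act) (P' : State), Fresh srt (T.bn α) Q → T.Step P α P' →
    ∃ Q', T.Step Q α Q' ∧ R P' Q'

/-- Bisimilarity. -/
def NTS.Bisimilar (P Q : State) : Prop := ∃ R, T.IsBisimulation R ∧ R P Q

/-- Raw formulas, in which bound names are not yet identified, and conjunctions are indexed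
families with fewer than `κ` members. -/
inductive Raw (Pred : Type uP) (Act : Type uA) (κ : Cardinal.{w}) : Type (max uP uA (w + 1))
  | conj (ι : Type w) (hι : #ι < κ) (f : ι → Raw Pred Act κ) : Raw Pred Act κ
  | neg (R : Raw Pred Act κ) : Raw Pred Act κ
  | pred (φ : Pred) : Raw Pred Act κ
  | act (α : Act) (R : Raw Pred Act κ) : Raw Pred Act κ

/-- Permutation distributes over all raw constructors. -/
def Raw.perm {κ : Cardinal.{w}} (π : NamePerm srt) : Raw Pred Act κ → Raw Pred Act κ
  | .conj ι hι f => .conj ι hι fun i => (f i).perm π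
  | .neg R => .neg (R.perm π)
  | .pred φ => .pred (π • φ)
  | .act α R => .act (π • α) (R.perm π)

instance {κ : Cardinal.{w}} : MulAction (NamePerm srt) (Raw Pred Act κ) where
  smul π R := R.perm π
  one_smul R := by
    change R.perm (1 : NamePerm srt) = R
    induction R with
    | conj ι hι f ih => simp only [Raw.perm, ih]
    | neg R ih => simp only [Raw.perm, ih]
    | pred φ => simp only [Raw.perm, one_smul]
    | act α R ih => simp only [Raw.perm, ih, one_smul]
  mul_smul π ρ R := by
    change R.perm (π * ρ) = (R.perm ρ).perm π
    induction R with
    | conj ι hι f ih => simp only [Raw.perm, ih]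
    | neg R ih => simp only [Raw.perm, ih]
    | pred φ => simp only [Raw.perm, mul_smul]
    | act α R ih => simp only [Raw.perm, ih, mul_smul]

variable (κ : Cardinal.{w})

/-- Alpha-equivalence of raw formulas: the least congruence in which conjunctions depend only on
their set of conjuncts and the names in `bn α` are bound in `act α R`. In the last rule, `N` is a
set of names that supports the alpha-equivalence class of `R`. -/
inductive Alpha : Raw Pred Act κ → Raw Pred Act κ → Prop
  | refl (R) : Alpha R R
  | symm {R S} : Alpha R S → Alpha S R
  | trans {R S U} : Alpha R S → Alpha S U → Alpha R U
  | conj {ι : Type w} {hι : #ι < κ} {f : ι → Raw Pred Act κ}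
      {ι' : Type w} {hι' : #ι' < κ} {g : ι' → Raw Pred Act κ}
      (u : ι → ι') (v : ι' → ι) (hu : ∀ i, Alpha (f i) (g (u i)))
      (hv : ∀ j, Alpha (f (v j)) (g j)) : Alpha (.conj ι hι f) (.conj ι' hι' g)
  | neg {R S} : Alpha R S → Alpha (.neg R) (.neg S)
  | act {R S} (α : Act) : Alpha R S → Alpha (.act α R) (.act α S)
  | bind (α : Act) (R) (π : NamePerm srt) (N : Finset 𝒩)
      (hN : ∀ ρ : NamePerm srt, (∀ a ∈ N, ρ • a = a) → Alpha (ρ • R) R)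
      (hπ : ∀ a ∈ (supp srt α ∪ (N : Set 𝒩)) \ (T.bn α : Set 𝒩), π • a = a) :
      Alpha (.act α R) (.act (π • α) (π • R))

variable {T κ}

theorem Alpha.smul {R S : Raw Pred Act κ} (h : Alpha T κ R S) (ρ : NamePerm srt) :
    Alpha T κ (ρ • R) (ρ • S) := by
  induction h with
  | refl R => exact .refl _
  | symm _ ih => exact .symm ih
  | trans _ _ ih1 ih2 => exact .trans ih1 ih2
  | conj u v _ _ ih1 ih2 => exact .conj u v ih1 ih2
  | neg _ ih => exact .neg ih
  | act α _ ih => exact .act _ ih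
  | bind α R π N hN hπ ih =>
    have key := Alpha.bind (T := T) (κ := κ) (ρ • α) (ρ • R) (ρ * π * ρ⁻¹) (permNames ρ N) ?_ ?_
    · have e1 : (ρ * π * ρ⁻¹) • ρ • α = ρ • π • α := by
        rw [smul_smul, inv_mul_cancel_right, mul_smul]
      have e2 : (ρ * π * ρ⁻¹) • ρ • R = ρ • π • R := by
        rw [smul_smul, inv_mul_cancel_right, mul_smul]
      rw [e1, e2] at key
      exact key
    · intro σ hσ
      have h1 : ∀ a ∈ N, (ρ⁻¹ * σ * ρ) • a = a := by
        intro a ha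
        rw [mul_smul, mul_smul, hσ (ρ • a) (by rwa [mem_permNames, inv_smul_smul]), inv_smul_smul]
      have h2 := ih _ h1
      rw [smul_smul, ← mul_assoc, ← mul_assoc, mul_inv_cancel, one_mul, mul_smul] at h2
      exact h2
    · rintro a ⟨ha, hb⟩
      have h1 : π • ρ⁻¹ • a = ρ⁻¹ • a := by
        apply hπ
        refine ⟨ha.imp (fun h => mem_supp_smul.1 h) (fun h => mem_permNames.1 h), fun hc => hb ?_⟩
        rw [T.bn_equivariant, Finset.mem_coe, mem_permNames]
        exact hc
      rw [mul_smul, mul_smul, h1, smul_inv_smul]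

variable (T κ)

/-- Alpha-equivalence as an equivalence relation. -/
def alphaSetoid : Setoid (Raw Pred Act κ) where
  r := Alpha T κ
  iseqv := ⟨Alpha.refl, Alpha.symm, Alpha.trans⟩

/-- Alpha-equivalence classes of raw formulas. -/
def AlphaClass : Type (max uP uA (w + 1)) := Quotient (alphaSetoid T κ)

variable {κ}

/-- The alpha-equivalence class of a raw formula. -/
def AlphaClass.mk (R : Raw Pred Act κ) : AlphaClass T κ := Quotient.mk (alphaSetoid T κ) R

variable {T}

theorem AlphaClass.mk_eq {R S : Raw Pred Act κ} : mk T R = mk T S ↔ Alpha T κ R S :=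
  ⟨fun h => Quotient.exact (s := alphaSetoid T κ) h,
    fun h => Quotient.sound (s := alphaSetoid T κ) h⟩

theorem AlphaClass.exists_rep (A : AlphaClass T κ) : ∃ R, mk T R = A := Quotient.exists_rep A

instance : MulAction (NamePerm srt) (AlphaClass T κ) where
  smul π := Quotient.map (sa := alphaSetoid T κ) (sb := alphaSetoid T κ) (fun R => π • R)
    (fun _ _ h => Alpha.smul h π)
  one_smul A := by
    obtain ⟨R, rfl⟩ := A.exists_rep
    exact congrArg (AlphaClass.mk T) (one_smul _ R)
  mul_smul π ρ A := by
    obtain ⟨R, rfl⟩ := A.exists_rep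
    exact congrArg (AlphaClass.mk T) (mul_smul π ρ R)

theorem AlphaClass.smul_mk (π : NamePerm srt) (R : Raw Pred Act κ) :
    π • mk T R = mk T (π • R) := rfl

/-- Negation on alpha-equivalence classes. -/
def AlphaClass.neg : AlphaClass T κ → AlphaClass T κ :=
  Quotient.map (sa := alphaSetoid T κ) (sb := alphaSetoid T κ) Raw.neg (fun _ _ h => Alpha.neg h)

/-- A state predicate as an alpha-equivalence class. -/
def AlphaClass.pred (φ : Pred) : AlphaClass T κ := mk T (.pred φ)

/-- The modality on alpha-equivalence classes. -/
def AlphaClass.act (α : Act) : AlphaClass T κ → AlphaClass T κ :=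
  Quotient.map (sa := alphaSetoid T κ) (sb := alphaSetoid T κ) (Raw.act α)
    (fun _ _ h => Alpha.act α h)

/-- A set of fewer than `κ` classes is enumerated by a type that may index a conjunction. -/
theorem AlphaClass.exists_index (s : Set (AlphaClass T κ))
    (hs : #s < Cardinal.lift.{max uP uA (w + 1)} κ) :
    ∃ (ι : Type w) (_ : #ι < κ) (f : ι → Raw Pred Act κ), Set.range (fun i => mk T (f i)) = s := by
  obtain ⟨c, hc, hcs⟩ := Cardinal.lt_lift_iff.1 hs
  obtain ⟨e⟩ : Nonempty (ULift.{max uP uA (w + 1)} c.out ≃ s) := by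
    rw [← Cardinal.eq, Cardinal.mk_uLift, Cardinal.mk_out, hcs]
  refine ⟨c.out, by rwa [Cardinal.mk_out], fun i => (e ⟨i⟩).1.exists_rep.choose, ?_⟩
  have h : ∀ i, mk T ((e ⟨i⟩).1.exists_rep.choose) = (e ⟨i⟩).1 :=
    fun i => (e ⟨i⟩).1.exists_rep.choose_spec
  ext A
  constructor
  · rintro ⟨i, rfl⟩
    simp only [h]
    exact (e ⟨i⟩).2
  · intro hA
    refine ⟨(e.symm ⟨A, hA⟩).down, ?_⟩
    simp only [h]
    exact congrArg Subtype.val (e.apply_symm_apply ⟨A, hA⟩)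

/-- The conjunction of a set of fewer than `κ` alpha-equivalence classes. -/
noncomputable def AlphaClass.conj (s : Set (AlphaClass T κ))
    (hs : #s < Cardinal.lift.{max uP uA (w + 1)} κ) : AlphaClass T κ :=
  mk T (.conj (exists_index s hs).choose (exists_index s hs).choose_spec.choose
    (exists_index s hs).choose_spec.choose_spec.choose)

theorem AlphaClass.mk_conj_congr {ι : Type w} {hι : #ι < κ} {f : ι → Raw Pred Act κ}
    {ι' : Type w} {hι' : #ι' < κ} {g : ι' → Raw Pred Act κ}
    (h : Set.range (fun i => mk T (f i)) = Set.range (fun j => mk T (g j))) :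
    mk T (.conj ι hι f) = mk T (.conj ι' hι' g) := by
  have h1 : ∀ i, ∃ j, mk T (f i) = mk T (g j) := fun i => by
    obtain ⟨j, hj⟩ := h ▸ Set.mem_range_self (f := fun i => mk T (f i)) i
    exact ⟨j, hj.symm⟩
  have h2 : ∀ j, ∃ i, mk T (f i) = mk T (g j) := fun j => by
    obtain ⟨i, hi⟩ := h.symm ▸ Set.mem_range_self (f := fun j => mk T (g j)) j
    exact ⟨i, hi⟩
  choose u hu using h1
  choose v hv using h2
  exact mk_eq.2 (.conj u v (fun i => mk_eq.1 (hu i)) (fun j => mk_eq.1 (hv j)))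

theorem AlphaClass.conj_eq_mk (s : Set (AlphaClass T κ))
    (hs : #s < Cardinal.lift.{max uP uA (w + 1)} κ) {ι : Type w} (hι : #ι < κ)
    (f : ι → Raw Pred Act κ) (hf : Set.range (fun i => mk T (f i)) = s) :
    conj s hs = mk T (.conj ι hι f) := by
  refine mk_conj_congr ?_
  rw [(exists_index s hs).choose_spec.choose_spec.choose_spec, hf]

theorem AlphaClass.card_smul (π : NamePerm srt) (s : Set (AlphaClass T κ)) :
    #(π • s : Set (AlphaClass T κ)) = #s :=
  Cardinal.mk_image_eq (MulAction.injective π)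

theorem AlphaClass.smul_conj (π : NamePerm srt) (s : Set (AlphaClass T κ))
    (hs : #s < Cardinal.lift.{max uP uA (w + 1)} κ) :
    π • conj s hs = conj (π • s) ((card_smul π s).trans_lt hs) := by
  obtain ⟨ι, hι, f, hf⟩ := exists_index s hs
  rw [conj_eq_mk s hs hι f hf, conj_eq_mk (π • s) _ hι (fun i => π • f i)]
  · rfl
  · subst hf
    rw [← Set.image_smul, ← Set.range_comp]
    rfl

variable (T κ)

/-- The classes built by the formula constructors, where every conjunction is over a finitely
supported set of formulas. -/
inductive AlphaClass.WF : AlphaClass T κ → Prop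
  | conj (s : Set (AlphaClass T κ)) (hs : #s < Cardinal.lift.{max uP uA (w + 1)} κ)
      (hfs : FinSupp srt s) (h : ∀ A ∈ s, WF A) : WF (AlphaClass.conj s hs)
  | neg (A : AlphaClass T κ) (h : WF A) : WF A.neg
  | pred (φ : Pred) : WF (AlphaClass.pred φ)
  | act (α : Act) (A : AlphaClass T κ) (h : WF A) : WF (AlphaClass.act α A)

variable {T κ}

theorem AlphaClass.smul_neg (π : NamePerm srt) (A : AlphaClass T κ) : π • A.neg = (π • A).neg := by
  obtain ⟨R, rfl⟩ := A.exists_rep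
  rfl

theorem AlphaClass.smul_act (π : NamePerm srt) (α : Act) (A : AlphaClass T κ) :
    π • A.act α = (π • A).act (π • α) := by
  obtain ⟨R, rfl⟩ := A.exists_rep
  rfl

theorem AlphaClass.WF.smul {A : AlphaClass T κ} (h : WF T κ A) (π : NamePerm srt) :
    WF T κ (π • A) := by
  induction h with
  | conj s hs hfs h ih =>
    rw [smul_conj]
    refine .conj _ _ (hfs.smul π) ?_
    rintro _ ⟨B, hB, rfl⟩
    exact ih B hB
  | neg A h ih => rw [smul_neg]; exact .neg _ ih
  | pred φ => exact .pred (π • φ)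
  | act α A h ih => rw [smul_act]; exact .act _ _ ih

variable (T κ)

/-- The formulas of the logic. -/
@[ext]
structure Formula : Type (max uP uA (w + 1)) where
  val : AlphaClass T κ
  wf : AlphaClass.WF T κ val

variable {T κ}

instance : MulAction (NamePerm srt) (Formula T κ) where
  smul π A := ⟨π • A.val, A.wf.smul π⟩
  one_smul A := Formula.ext (one_smul _ A.val)
  mul_smul π ρ A := Formula.ext (mul_smul π ρ A.val)

theorem Formula.val_smul (π : NamePerm srt) (A : Formula T κ) : (π • A).1 = π • A.val := rfl

theorem Formula.image_val_smul (π : NamePerm srt) (s : Set (Formula T κ)) :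
    Formula.val '' (π • s) = π • (Formula.val '' s : Set (AlphaClass T κ)) := by
  rw [← Set.image_smul, ← Set.image_smul, Set.image_image, Set.image_image]
  rfl

/-- The sets of formulas whose conjunction is a formula: those of cardinality less than `κ` that
are finitely supported. -/
def Formula.Bounded (s : Set (Formula T κ)) : Prop :=
  #s < Cardinal.lift.{max uP uA (w + 1)} κ ∧ FinSupp srt s

/-- The conjunction of a set of formulas. -/
noncomputable def Formula.conj (s : Set (Formula T κ)) (hs : Formula.Bounded s) : Formula T κ :=
  ⟨AlphaClass.conj (Formula.val '' s)
      ((Cardinal.mk_image_eq (fun _ _ => Formula.ext)).trans_lt hs.1),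
    .conj _ _
      (by
        obtain ⟨N, hN⟩ := hs.2
        refine ⟨N, fun π hπ => ?_⟩
        rw [← Formula.image_val_smul, hN π hπ])
      (by
        rintro _ ⟨A, _, rfl⟩
        exact A.wf)⟩

/-- Negation. -/
def Formula.neg (A : Formula T κ) : Formula T κ := ⟨A.val.neg, .neg _ A.wf⟩

/-- State predicates as formulas. -/
def Formula.pred (φ : Pred) : Formula T κ := ⟨AlphaClass.pred φ, .pred φ⟩

/-- The action modality; the names in `bn α` are bound. -/
def Formula.act (α : Act) (A : Formula T κ) : Formula T κ := ⟨A.val.act α, .act α _ A.wf⟩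

theorem Formula.smul_neg (π : NamePerm srt) (A : Formula T κ) : π • A.neg = (π • A).neg :=
  Formula.ext (AlphaClass.smul_neg π A.val)

theorem Formula.Bounded.neg {s : Set (Formula T κ)} (hs : Bounded s) :
    Bounded (Formula.neg '' s) := by
  refine ⟨Cardinal.mk_image_le.trans_lt hs.1, ?_⟩
  obtain ⟨N, hN⟩ := hs.2
  refine ⟨N, fun π hπ => ?_⟩
  have h : π • s = s := hN π hπ
  conv_rhs => rw [← h]
  rw [← Set.image_smul, ← Set.image_smul, Set.image_image, Set.image_image]
  simp only [Formula.smul_neg]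

/-- The disjunction of a set of formulas: the negated conjunction of the negations. -/
noncomputable def Formula.disj (s : Set (Formula T κ)) (hs : Formula.Bounded s) : Formula T κ :=
  (Formula.conj (Formula.neg '' s) hs.neg).neg

theorem Formula.smul_conj (π : NamePerm srt) (s : Set (Formula T κ)) (hs : Bounded s) :
    ∃ h : Bounded (π • s), π • conj s hs = conj (π • s) h := by
  refine ⟨⟨(Cardinal.mk_image_eq (MulAction.injective π)).trans_lt hs.1, hs.2.smul π⟩, ?_⟩
  apply Formula.ext
  refine (AlphaClass.smul_conj π (Formula.val '' s)
    ((Cardinal.mk_image_eq (fun _ _ => Formula.ext)).trans_lt hs.1)).trans ?_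
  simp only [conj, image_val_smul]

/-- Formulas form a nominal set. -/
theorem Formula.finSupp (A : Formula T κ) : FinSupp srt A := by
  suffices h : FinSupp srt A.val by
    obtain ⟨N, hN⟩ := h
    exact ⟨N, fun π hπ => Formula.ext (hN π hπ)⟩
  obtain ⟨A, hA⟩ := A
  change FinSupp srt A
  induction hA with
  | conj s hs hfs h ih =>
    obtain ⟨N, hN⟩ := hfs
    refine ⟨N, fun π hπ => ?_⟩
    have h : π • s = s := hN π hπ
    simp only [AlphaClass.smul_conj, h]
  | neg A h ih =>
    obtain ⟨N, hN⟩ := ih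
    exact ⟨N, fun π hπ => by rw [AlphaClass.smul_neg, hN π hπ]⟩
  | pred φ =>
    obtain ⟨N, hN⟩ := T.pred_finSupp φ
    exact ⟨N, fun π hπ => congrArg AlphaClass.pred (hN π hπ)⟩
  | act α A h ih =>
    classical
    obtain ⟨N, hN⟩ := ih
    obtain ⟨M, hM⟩ := T.act_finSupp α
    refine ⟨N ∪ M, fun π hπ => ?_⟩
    rw [AlphaClass.smul_act, hN π fun a ha => hπ (by simp [Finset.mem_coe.1 ha]),
      hM π fun a ha => hπ (by simp [Finset.mem_coe.1 ha])]

variable (T)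

/-- Validity of raw formulas. In the last clause `act (π • α) (π • R)` ranges over the
alpha-variants of `act α R` whose binding names are fresh for `P`, and validity of `π • R` in `P'`
is expressed as validity of `R` in `π⁻¹ • P'`; see `Formula.valid_act` for the usual form. -/
def Raw.Valid : Raw Pred Act κ → State → Prop
  | .conj _ _ f, P => ∀ i, (f i).Valid P
  | .neg R, P => ¬ R.Valid P
  | .pred φ, P => T.holds P φ
  | .act α R, P => ∃ π : NamePerm srt,
      (∀ a ∈ (supp srt α ∪ supp srt (AlphaClass.mk T R)) \ (T.bn α : Set 𝒩), π • a = a) ∧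
      Fresh srt (T.bn (π • α)) P ∧ ∃ P', T.Step P (π • α) P' ∧ R.Valid (π⁻¹ • P')

variable {T}

theorem Fresh.smul {X : Type ux} [MulAction (NamePerm srt) X] {N : Finset 𝒩} {x : X}
    (π : NamePerm srt) (h : Fresh srt N x) : Fresh srt (permNames π N) (π • x) :=
  fun _ ha hb => h _ (mem_permNames.1 ha) (mem_supp_smul.1 hb)

theorem Raw.Valid.smul_act {α : Act} {R : Raw Pred Act κ} {P : State}
    (hR : ∀ (ρ : NamePerm srt) (P : State), (ρ • R).Valid T (ρ • P) ↔ R.Valid T P)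
    (ρ : NamePerm srt) (h : (Raw.act α R).Valid T P) :
    (Raw.act (ρ • α) (ρ • R)).Valid T (ρ • P) := by
  obtain ⟨π, hπ, hf, P', hs, hv⟩ := h
  have e : ∀ {Y : Type _} [MulAction (NamePerm srt) Y] (y : Y),
      (ρ * π * ρ⁻¹) • ρ • y = ρ • π • y := by
    intro Y _ y
    rw [smul_smul, inv_mul_cancel_right, mul_smul]
  refine ⟨ρ * π * ρ⁻¹, ?_, ?_, ρ • P', ?_, ?_⟩
  · rintro a ⟨ha, hb⟩
    have h1 : π • ρ⁻¹ • a = ρ⁻¹ • a := by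
      apply hπ
      refine ⟨ha.imp (fun h => mem_supp_smul.1 h) (fun h => ?_), fun hc => hb ?_⟩
      · rw [← AlphaClass.smul_mk] at h
        exact mem_supp_smul.1 h
      · rw [T.bn_equivariant, Finset.mem_coe, mem_permNames]
        exact hc
    rw [mul_smul, mul_smul, h1, smul_inv_smul]
  · rw [e, T.bn_equivariant]
    exact hf.smul ρ
  · rw [e]
    exact (T.step_smul _ _ _ _).2 hs
  · have h2 : (ρ * π * ρ⁻¹)⁻¹ • ρ • P' = ρ • π⁻¹ • P' := by
      rw [smul_smul, smul_smul]
      congr 1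
      group
    rw [h2]
    exact (hR _ _).2 hv

/-- Validity of raw formulas is equivariant. -/
theorem Raw.Valid.smul (R : Raw Pred Act κ) :
    ∀ (ρ : NamePerm srt) (P : State), (ρ • R).Valid T (ρ • P) ↔ R.Valid T P := by
  induction R with
  | conj ι hι f ih => exact fun ρ P => forall_congr' fun i => ih i ρ P
  | neg R ih => exact fun ρ P => not_congr (ih ρ P)
  | pred φ => exact fun ρ P => T.holds_equivariant ρ P φ
  | act α R ih =>
    intro ρ P
    refine ⟨fun h => ?_, Raw.Valid.smul_act ih ρ⟩
    have h1 := Raw.Valid.smul_act (R := ρ • R) (fun σ Q => ?_) ρ⁻¹ h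
    · simpa only [inv_smul_smul] using h1
    · have h2 := ih (σ * ρ) (ρ⁻¹ • Q)
      have h3 := ih ρ (ρ⁻¹ • Q)
      rw [mul_smul, mul_smul, smul_inv_smul] at h2
      rw [smul_inv_smul] at h3
      exact h2.trans h3.symm

theorem Raw.Valid.smul_iff (R : Raw Pred Act κ) (π : NamePerm srt) (P : State) :
    (π • R).Valid T P ↔ R.Valid T (π⁻¹ • P) := by
  rw [← Raw.Valid.smul R π, smul_inv_smul]

/-- Alpha-equivalent raw formulas are valid in the same states. -/
theorem Alpha.valid_iff {R S : Raw Pred Act κ} (h : Alpha T κ R S) :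
    ∀ P : State, R.Valid T P ↔ S.Valid T P := by
  induction h with
  | refl R => exact fun P => Iff.rfl
  | symm _ ih => exact fun P => (ih P).symm
  | trans _ _ ih1 ih2 => exact fun P => (ih1 P).trans (ih2 P)
  | conj u v _ _ ih1 ih2 =>
    exact fun P => ⟨fun h j => (ih2 j P).1 (h (v j)), fun h i => (ih1 i P).2 (h (u i))⟩
  | neg _ ih => exact fun P => not_congr (ih P)
  | act α h ih =>
    intro P
    simp only [Raw.Valid, AlphaClass.mk_eq.2 h, ih]
  | bind α R τ N hN hτ ih =>
    intro P
    have hfix : ∀ a ∈ (supp srt α ∪ supp srt (AlphaClass.mk T R)) \ (T.bn α : Set 𝒩),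
        τ • a = a := by
      rintro a ⟨ha, hb⟩
      refine hτ a ⟨ha.imp id fun h => ?_, hb⟩
      exact h N fun ρ hρ => AlphaClass.mk_eq.2 (hN ρ fun b hb => hρ hb)
    have hmem : ∀ a : 𝒩, τ • a ∈ (supp srt (τ • α) ∪ supp srt (AlphaClass.mk T (τ • R))) \
        (T.bn (τ • α) : Set 𝒩) ↔
        a ∈ (supp srt α ∪ supp srt (AlphaClass.mk T R)) \ (T.bn α : Set 𝒩) := by
      intro a
      rw [← AlphaClass.smul_mk, T.bn_equivariant]
      simp only [Set.mem_sdiff, Set.mem_union, Finset.mem_coe, mem_permNames, mem_supp_smul,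
        inv_smul_smul]
    constructor
    · rintro ⟨π, hπ, hf, P', hs, hv⟩
      refine ⟨π * τ⁻¹, ?_, ?_, P', ?_, ?_⟩
      · intro a ha
        have h1 := (hmem (τ⁻¹ • a)).1 (by rwa [smul_inv_smul])
        have h2 := hfix _ h1
        rw [smul_inv_smul] at h2
        rw [← h2] at h1
        rw [mul_smul, ← h2, hπ a h1]
      · rwa [mul_smul, inv_smul_smul]
      · rwa [mul_smul, inv_smul_smul]
      · rw [Raw.Valid.smul_iff, ← mul_smul]
        simpa using hv
    · rintro ⟨π, hπ, hf, P', hs, hv⟩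
      refine ⟨π * τ, ?_, ?_, P', ?_, ?_⟩
      · intro a ha
        have h1 := hπ _ ((hmem a).2 ha)
        rw [mul_smul, h1, hfix a ha]
      · rwa [mul_smul]
      · rwa [mul_smul]
      · rw [Raw.Valid.smul_iff, ← mul_smul] at hv
        simpa using hv

/-- Validity of alpha-equivalence classes. -/
def AlphaClass.Valid (P : State) (A : AlphaClass T κ) : Prop :=
  Quotient.lift (s := alphaSetoid T κ) (fun R => R.Valid T P)
    (fun _ _ h => propext (Alpha.valid_iff h P)) A

/-- Validity: the formula `A` holds in the state `P`. -/
def Formula.Valid (P : State) (A : Formula T κ) : Prop := A.val.Valid P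

theorem Formula.valid_conj {P : State} {s : Set (Formula T κ)} {hs : Bounded s} :
    Valid P (conj s hs) ↔ ∀ A ∈ s, Valid P A := by
  have h : ∀ (t : Set (AlphaClass T κ)) (ht : #t < Cardinal.lift.{max uP uA (w + 1)} κ),
      (AlphaClass.conj t ht).Valid P ↔ ∀ A ∈ t, A.Valid P := by
    intro t ht
    obtain ⟨ι, hι, f, hf⟩ := AlphaClass.exists_index t ht
    rw [AlphaClass.conj_eq_mk t ht hι f hf]
    subst hf
    rw [Set.forall_mem_range]
    rfl
  refine (h (Formula.val '' s)
    ((Cardinal.mk_image_eq (fun _ _ => Formula.ext)).trans_lt hs.1)).trans ?_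
  rw [Set.forall_mem_image]
  rfl

theorem Formula.valid_neg {P : State} {A : Formula T κ} : Valid P A.neg ↔ ¬ Valid P A := by
  obtain ⟨A, hA⟩ := A
  obtain ⟨R, rfl⟩ := A.exists_rep
  rfl

theorem Formula.valid_pred {P : State} {φ : Pred} :
    Valid P (pred φ : Formula T κ) ↔ T.holds P φ := Iff.rfl

/-- Validity is equivariant. -/
theorem Formula.valid_smul (π : NamePerm srt) (P : State) (A : Formula T κ) :
    Valid (π • P) (π • A) ↔ Valid P A := by
  obtain ⟨A, hA⟩ := A
  obtain ⟨R, rfl⟩ := A.exists_rep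
  exact Raw.Valid.smul R π P

/-- Validity of the modality, for a representative whose binding names are fresh. -/
theorem Formula.valid_act (hsrt : ∀ a : 𝒩, {b | srt b = srt a}.Infinite) {P : State} {α : Act}
    {A : Formula T κ} (hα : Fresh srt (T.bn α) P) :
    Valid P (act α A) ↔ ∃ P', T.Step P α P' ∧ Valid P' A := by
  have hA := A.finSupp
  obtain ⟨A, hwf⟩ := A
  obtain ⟨R, rfl⟩ := A.exists_rep
  have hR : FinSupp srt (AlphaClass.mk T R) := by
    obtain ⟨N, hN⟩ := hA
    exact ⟨N, fun π hπ => congrArg Formula.val (hN π hπ)⟩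
  constructor
  · rintro ⟨π, hπ, hf, P', hs, hv⟩
    obtain ⟨σ, h1, h2⟩ := exists_perm_agree π (T.bn α)
    have agree : ∀ a ∈ supp srt α ∪ supp srt (AlphaClass.mk T R), (σ⁻¹ * π) • a = a := by
      intro a ha
      rw [mul_smul, inv_smul_eq_iff]
      by_cases hb : a ∈ T.bn α
      · exact (h1 a hb).symm
      · have h3 := hπ a ⟨ha, hb⟩
        rw [h3, h2 a hb]
        rw [mem_permNames, inv_smul_eq_iff.2 h3.symm]
        exact hb
    have e1 : π • α = σ • α := by
      have := (T.act_finSupp α).supports_supp hsrt (σ⁻¹ * π) fun a ha => agree a (Or.inl ha)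
      rwa [mul_smul, inv_smul_eq_iff] at this
    have e2 : AlphaClass.mk T (π • R) = AlphaClass.mk T (σ • R) := by
      have := hR.supports_supp hsrt (σ⁻¹ * π) fun a ha => agree a (Or.inr ha)
      rwa [mul_smul, inv_smul_eq_iff] at this
    have e3 : σ • P = P := by
      refine (T.state_finSupp P).supports_supp hsrt σ fun a ha => ?_
      refine h2 a (fun hc => hα a hc ha) fun hc => hf a ?_ ha
      rwa [T.bn_equivariant]
    refine ⟨σ⁻¹ • P', ?_, ?_⟩
    · rw [← T.step_smul σ, e3, smul_inv_smul, ← e1]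
      exact hs
    · rw [← Raw.Valid.smul_iff, Alpha.valid_iff (AlphaClass.mk_eq.1 e2),
        Raw.Valid.smul_iff] at hv
      exact hv
  · rintro ⟨P', hs, hv⟩
    refine ⟨1, fun a _ => one_smul _ a, by rwa [one_smul], P', by rwa [one_smul], ?_⟩
    rw [inv_one, one_smul]
    exact hv

theorem Formula.valid_disj {P : State} {s : Set (Formula T κ)} {hs : Bounded s} :
    Valid P (disj s hs) ↔ ∃ A ∈ s, Valid P A := by
  unfold disj
  rw [valid_neg, valid_conj, Set.forall_mem_image]
  simp only [valid_neg]
  push Not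
  rfl

/-- Alpha-conversion of the modality. -/
theorem Formula.act_eq (hsrt : ∀ a : 𝒩, {b | srt b = srt a}.Infinite) (α : Act)
    (A : Formula T κ) (π : NamePerm srt)
    (hπ : ∀ a ∈ (supp srt α ∪ supp srt A) \ (T.bn α : Set 𝒩), π • a = a) :
    act α A = act (π • α) (π • A) := by
  have hA := A.finSupp
  obtain ⟨N, hN⟩ := hA
  have hfin : (supp srt A).Finite := N.finite_toSet.subset fun a ha => ha N hN
  have hs := A.finSupp.supports_supp hsrt
  obtain ⟨A, hwf⟩ := A
  obtain ⟨R, rfl⟩ := A.exists_rep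
  apply Formula.ext
  refine AlphaClass.mk_eq.2 (Alpha.bind α R π hfin.toFinset (fun ρ hρ => ?_) ?_)
  · exact AlphaClass.mk_eq.1 (congrArg Formula.val (hs ρ fun a ha => hρ a (by simpa using ha)))
  · simpa using hπ

variable (T κ)

/-- Logical equivalence of states. -/
def NTS.LogEq (P Q : State) : Prop := ∀ A : Formula T κ, A.Valid P ↔ A.Valid Q

variable {T κ}

/-- `A` is a distinguishing formula for `P` and `Q`. -/
def Formula.Distinguishes (A : Formula T κ) (P Q : State) : Prop := A.Valid P ∧ ¬ A.Valid Q

/-- `A` is a characteristic formula for `P`. -/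
def Formula.IsCharacteristic (A : Formula T κ) (P : State) : Prop :=
  ∀ Q, T.Bisimilar P Q ↔ A.Valid Q

/-- `B` chooses, for all states `P` and `Q` that are not logically equivalent, a distinguishing
formula whose support is contained in that of `P`. -/
def Formula.IsChoice (B : State → State → Formula T κ) : Prop :=
  ∀ P Q, ¬ T.LogEq κ P Q → (B P Q).Distinguishes P Q ∧ supp srt (B P Q) ⊆ supp srt P

variable (T)

/-- A well-formed property of states: finitely supported and closed under bisimilarity. -/
def NTS.WellFormed (S : Set State) : Prop :=
  FinSupp srt S ∧ ∀ P ∈ S, ∀ Q, T.Bisimilar P Q → Q ∈ S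

end NTS

end NomHML

open NomHML

/-! A conjunction is a formula only if it has fewer than `κ` conjuncts and the set of conjuncts is
finitely supported. Size is never the difficulty: the conjunctions used are indexed by permutations,
which are countably many, or by states. Finite support is obtained in two ways.

For conjunctions over states `Q` with `P` held fixed, each conjunct has support inside `supp P`, so
this one finite set supports any set of such conjuncts, however it was chosen. Such distinguishing
formulas exist: if `A` distinguishes `P` from `Q`, take the conjunction of all `g • A` with `g`
fixing `supp P` pointwise. Each `g` fixes `P`, so `P` satisfies every conjunct; `Q` fails the one
for `g = 1`; and the family is invariant under all such `g` (`exists_distinguishes_supp_subset`).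
Conjoining these formulas over the `α`-successors of `Q` gives the Hennessy–Milner argument that
logical equivalence is a bisimulation. The converse is induction on formulas, so the two relations
coincide (`bisimilar_iff_logEq`), and the conjunction of the distinguishing formulas over all
inequivalent `Q` is characteristic for `P`.

For the disjunction over `S` the supports of the `Char P'` have no common finite bound. What helps
is equivariance: if `P' ↦ Char P'` is equivariant, whatever supports `S` supports its image. An
arbitrary choice `B` is not equivariant, but the conjunction of `π⁻¹ • B (π • P) (π • Q)` over all
`π` is, since moving it by a permutation only reindexes the conjuncts (`smul_orbit`); the support
bound and the distinguishing property survive. -/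

namespace NomHML

/-! ### Finite supports and countability of the permutation group -/

section Support

variable {𝒩 : Type un} {Srt : Type us} {srt : 𝒩 → Srt} {X : Type ux} [MulAction (NamePerm srt) X]

theorem FinSupp.finite_supp {x : X} (h : FinSupp srt x) : (supp srt x).Finite := by
  obtain ⟨N, hN⟩ := h
  exact N.finite_toSet.subset fun a ha => ha N hN

theorem supp_subset_of_supports {x : X} {s : Set 𝒩} (hs : s.Finite)
    (h : MulAction.Supports (NamePerm srt) s x) : supp srt x ⊆ s := by
  intro a ha
  have h1 := ha hs.toFinset (by rwa [Set.Finite.coe_toFinset])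
  rwa [Set.Finite.mem_toFinset] at h1

theorem FinSupp.of_supports {x : X} {s : Set 𝒩} (hs : s.Finite)
    (h : MulAction.Supports (NamePerm srt) s x) : FinSupp srt x :=
  ⟨hs.toFinset, by rwa [Set.Finite.coe_toFinset]⟩

/-- A set is supported by any set of names that supports all of its elements. -/
theorem supports_set_of_forall {s : Set 𝒩} {t : Set X}
    (h : ∀ x ∈ t, MulAction.Supports (NamePerm srt) s x) :
    MulAction.Supports (NamePerm srt) s t := by
  intro π hπ
  rw [← Set.image_smul]
  exact (Set.image_congr fun x hx => h x hx π hπ).trans (Set.image_id' t)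

/-- A permutation is determined by its graph on the finitely many names it moves, and a countable
set has only countably many finite subsets. Countability is what keeps conjunctions over
permutations below `κ`. -/
instance countable_namePerm [Countable 𝒩] : Countable (NamePerm srt) := by
  classical
  let g : NamePerm srt → Finset (𝒩 × 𝒩) := fun π => π.2.1.toFinset.image fun a => (a, π.1 a)
  have hg : ∀ (π : NamePerm srt) (a b : 𝒩), (a, b) ∈ g π ↔ π.1 a ≠ a ∧ π.1 a = b := by
    intro π a b
    simp only [g, Finset.mem_image, Set.Finite.mem_toFinset, Set.mem_ofPred_eq, Prod.mk.injEq]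
    constructor
    · rintro ⟨c, hc, rfl, rfl⟩
      exact ⟨hc, rfl⟩
    · rintro ⟨h, rfl⟩
      exact ⟨a, h, rfl, rfl⟩
  have key : ∀ π ρ : NamePerm srt, g π = g ρ → ∀ a, π.1 a ≠ a → ρ.1 a = π.1 a := by
    intro π ρ h a ha
    have h1 := (hg π a _).2 ⟨ha, rfl⟩
    rw [h] at h1
    exact ((hg ρ a _).1 h1).2
  refine Function.Injective.countable (f := g) fun π ρ h => ?_
  apply Subtype.ext
  ext a
  by_cases h1 : π.1 a = a
  · by_cases h2 : ρ.1 a = a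
    · rw [h1, h2]
    · exact key ρ π h.symm a h2
  · exact (key π ρ h a h1).symm

end Support

/-! ### Renaming binders; equivariance of bisimilarity and of logical equivalence -/

section Logic

variable {𝒩 : Type un} {Srt : Type us} {srt : 𝒩 → Srt} {State : Type uS} {Pred : Type uP}
  {Act : Type uA} [MulAction (NamePerm srt) State] [MulAction (NamePerm srt) Pred]
  [MulAction (NamePerm srt) Act] {T : NTS srt State Pred Act} {κ : Cardinal.{w}}

/-- The binding names of an action can be renamed so as to avoid a finite set `F`, without
affecting the other names in a finite set `K`. -/
theorem NTS.exists_perm_bn_fresh (T : NTS srt State Pred Act)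
    (hsrt : ∀ a : 𝒩, {b | srt b = srt a}.Infinite) (α : Act) {K F : Set 𝒩} (hK : K.Finite)
    (hF : F.Finite) :
    ∃ π : NamePerm srt, (∀ a ∈ K \ (T.bn α : Set 𝒩), π • a = a) ∧
      ∀ a ∈ T.bn (π • α), a ∉ F := by
  obtain ⟨π, h1, h2⟩ := exists_perm_fresh hsrt (T.bn α) (hK.union hF).toFinset
  refine ⟨π, fun a ha => h2 a (by simp [ha.1]) ha.2, fun a ha hc => ?_⟩
  rw [T.bn_equivariant, mem_permNames] at ha
  apply h1 _ ha
  rw [smul_inv_smul]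
  simp [hc]

/-- Alpha-conversion of transitions. -/
theorem NTS.Step.smul_of_fixes (hsrt : ∀ a : 𝒩, {b | srt b = srt a}.Infinite) {P P' : State}
    {α : Act} (h : T.Step P α P') (π : NamePerm srt)
    (hπ : ∀ a ∈ (supp srt α ∪ supp srt P') \ (T.bn α : Set 𝒩), π • a = a) :
    T.Step P (π • α) (π • P') := by
  -- Alpha-equivalence of residuals refers to the support of the pair, whereas `hπ` speaks of its
  -- components.
  have hsub : supp srt (α, P') ⊆ supp srt α ∪ supp srt P' := by
    apply supp_subset_of_supports
      ((T.act_finSupp α).finite_supp.union (T.state_finSupp P').finite_supp)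
    intro ρ hρ
    exact Prod.ext
      ((T.act_finSupp α).supports_supp hsrt ρ fun a ha => hρ (Or.inl ha))
      ((T.state_finSupp P').supports_supp hsrt ρ fun a ha => hρ (Or.inr ha))
  have e : NameAbs.mk srt (T.bn α) (α, P') =
      NameAbs.mk srt (T.bn (π • α)) (π • α, π • P') :=
    Quotient.sound (s := absSetoid srt (Act × State))
      ⟨π, (T.bn_equivariant π α).symm, rfl, fun a ha => hπ a ⟨hsub ha.1, ha.2⟩⟩
  unfold NTS.Step
  rw [← e]
  exact h

theorem NTS.Bisimilar.refl (P : State) : T.Bisimilar P P :=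
  ⟨Eq, ⟨fun _ _ h => h.symm, by rintro _ _ rfl _ h; exact h,
    by rintro _ _ rfl _ P' _ h; exact ⟨P', h, rfl⟩⟩, rfl⟩

theorem NTS.Bisimilar.symm {P Q : State} (h : T.Bisimilar P Q) : T.Bisimilar Q P := by
  obtain ⟨R, hR, h⟩ := h
  exact ⟨R, hR, hR.symm _ _ h⟩

/-- Bisimilarity is equivariant. -/
theorem NTS.Bisimilar.smul {P Q : State} (h : T.Bisimilar P Q) (π : NamePerm srt) :
    T.Bisimilar (π • P) (π • Q) := by
  obtain ⟨R, hR, h⟩ := h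
  refine ⟨fun P Q => R (π⁻¹ • P) (π⁻¹ • Q), ⟨fun P Q h => hR.symm _ _ h, ?_, ?_⟩, ?_⟩
  · intro P Q h φ hφ
    rw [← T.holds_equivariant π⁻¹] at hφ ⊢
    exact hR.static _ _ h _ hφ
  · intro P Q h α P' hα hs
    obtain ⟨Q', h1, h2⟩ := hR.sim _ _ h (π⁻¹ • α) (π⁻¹ • P')
      (by rw [T.bn_equivariant]; exact hα.smul π⁻¹) ((T.step_smul _ _ _ _).2 hs)
    refine ⟨π • Q', ?_, by rwa [inv_smul_smul]⟩
    rw [← T.step_smul π⁻¹, inv_smul_smul]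
    exact h1
  · simpa only [inv_smul_smul] using h

theorem Formula.valid_smul_iff (π : NamePerm srt) (P : State) (A : Formula T κ) :
    Valid P (π • A) ↔ Valid (π⁻¹ • P) A := by
  rw [← Formula.valid_smul π (π⁻¹ • P), smul_inv_smul]

theorem NTS.LogEq.smul_iff (π : NamePerm srt) {P Q : State} :
    T.LogEq κ (π • P) (π • Q) ↔ T.LogEq κ P Q := by
  constructor
  · intro h A
    rw [← Formula.valid_smul π P, ← Formula.valid_smul π Q]
    exact h _
  · intro h A
    have h1 := h (π⁻¹ • A)
    rwa [Formula.valid_smul_iff, Formula.valid_smul_iff, inv_inv] at h1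

/-! ### Bisimilar states satisfy the same formulas -/

/-- Structural induction on formulas. -/
theorem Formula.induction {motive : Formula T κ → Prop}
    (conj : ∀ s hs, (∀ A ∈ s, motive A) → motive (conj s hs))
    (neg : ∀ A, motive A → motive A.neg) (pred : ∀ φ, motive (pred φ))
    (act : ∀ α A, motive A → motive (act α A)) (A : Formula T κ) : motive A := by
  obtain ⟨A, hA⟩ := A
  induction hA with
  | conj s hs hfs h ih =>
    -- Well-formedness quantifies over sets of classes. As `Formula.val` is injective, pulling `s`
    -- back to formulas preserves both its size and its finite support.
    let t : Set (Formula T κ) := {A | A.val ∈ s}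
    have ht : Formula.val '' t = s := by
      ext A
      exact ⟨by rintro ⟨A, hA, rfl⟩; exact hA, fun hA => ⟨⟨A, h A hA⟩, hA, rfl⟩⟩
    have hb : Bounded t := by
      constructor
      · rw [← Cardinal.mk_image_eq (f := Formula.val) (fun _ _ => Formula.ext), ht]
        exact hs
      · obtain ⟨N, hN⟩ := hfs
        refine ⟨N, fun π hπ => ?_⟩
        have h1 : π • s = s := hN π hπ
        have hinj : Function.Injective (Formula.val (T := T) (κ := κ)) := fun _ _ => Formula.ext
        apply hinj.image_injective
        rw [image_val_smul, ht, h1]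
    have e : Formula.conj t hb = ⟨_, .conj s hs hfs h⟩ := by
      apply Formula.ext
      simp only [Formula.conj, ht]
    rw [← e]
    exact conj t hb fun A hA => ih A.val hA
  | neg A h ih => exact neg ⟨A, h⟩ ih
  | pred φ => exact pred φ
  | act α A h ih => exact act α ⟨A, h⟩ ih

/-- Induction on `A` with both states universally quantified: negation swaps them by symmetry, and
the modality applies the hypothesis to renamed successors. -/
theorem Formula.valid_of_bisimilar (hsrt : ∀ a : 𝒩, {b | srt b = srt a}.Infinite)
    (A : Formula T κ) : ∀ P Q : State, T.Bisimilar P Q → A.Valid P → A.Valid Q := by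
  induction A using Formula.induction with
  | conj s hs ih =>
    intro P Q h hP
    rw [valid_conj] at hP ⊢
    exact fun A hA => ih A hA P Q h (hP A hA)
  | neg A ih =>
    intro P Q h hP
    rw [valid_neg] at hP ⊢
    exact fun hQ => hP (ih Q P h.symm hQ)
  | pred φ =>
    rintro P Q ⟨R, hR, h⟩ hP
    exact hR.static P Q h φ hP
  | act α A ih =>
    intro P Q h hP
    -- The binders must avoid `P` to unfold validity there, and `Q` for both the simulation clause
    -- and validity there.
    obtain ⟨π, h1, h2⟩ := T.exists_perm_bn_fresh hsrt α
      ((T.act_finSupp α).finite_supp.union A.finSupp.finite_supp)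
      ((T.state_finSupp P).finite_supp.union (T.state_finSupp Q).finite_supp)
    rw [act_eq hsrt α A π h1] at hP ⊢
    rw [valid_act hsrt fun a ha hc => h2 a ha (Or.inl hc)] at hP
    obtain ⟨P', hs, hv⟩ := hP
    have hQ : Fresh srt (T.bn (π • α)) Q := fun a ha hc => h2 a ha (Or.inr hc)
    obtain ⟨R, hR, h⟩ := h
    obtain ⟨Q', hs', h'⟩ := hR.sim P Q h _ P' hQ hs
    rw [valid_act hsrt hQ]
    refine ⟨Q', hs', ?_⟩
    -- The induction hypothesis concerns `A`, not `π • A`, so the renaming is moved onto the states.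
    rw [valid_smul_iff] at hv ⊢
    exact ih _ _ (NTS.Bisimilar.smul ⟨R, hR, h'⟩ π⁻¹) hv

/-! ### Bounded conjunctions and distinguishing formulas of small support -/

theorem Formula.card_range_lt {ι : Type ux} (f : ι → Formula T κ)
    (hι : Cardinal.lift.{w} #ι < Cardinal.lift.{ux} κ) :
    #(Set.range f) < Cardinal.lift.{max uP uA (w + 1)} κ := by
  have h1 := Cardinal.mk_range_le_lift (f := f)
  have h2 := Cardinal.lift_lt.{_, max uP uA (w + 1)}.2 hι
  rw [← Cardinal.lift_lt.{_, ux}]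
  refine h1.trans_lt ?_
  simpa only [Cardinal.lift_lift, Cardinal.lift_umax, Cardinal.lift_id] using h2

theorem Formula.card_image_lt {ι : Type ux} (f : ι → Formula T κ) (s : Set ι)
    (hι : Cardinal.lift.{w} #ι < Cardinal.lift.{ux} κ) :
    #(f '' s) < Cardinal.lift.{max uP uA (w + 1)} κ :=
  (Cardinal.mk_le_mk_of_subset (Set.image_subset_range f s)).trans_lt (card_range_lt f hι)

theorem Formula.card_range_lt_of_countable {ι : Type ux} [Countable ι] (hκ : ℵ₀ < κ)
    (f : ι → Formula T κ) : #(Set.range f) < Cardinal.lift.{max uP uA (w + 1)} κ := by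
  apply card_range_lt
  refine (Cardinal.lift_le.2 (Cardinal.mk_le_aleph0 (α := ι))).trans_lt ?_
  rw [Cardinal.lift_aleph0]
  exact Cardinal.aleph0_lt_lift.2 hκ

theorem Formula.supp_conj_subset {s : Set (Formula T κ)} (hs : Bounded s) {N : Set 𝒩}
    (hN : N.Finite) (h : MulAction.Supports (NamePerm srt) N s) :
    supp srt (conj s hs) ⊆ N := by
  apply supp_subset_of_supports hN
  intro π hπ
  obtain ⟨hb, e⟩ := smul_conj π s hs
  have h1 : π • s = s := h π hπ
  rw [e]
  simp only [h1]

/-- A formula separating the states in the wrong direction is replaced by its negation. -/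
theorem Formula.exists_distinguishes {P Q : State} (h : ¬ T.LogEq κ P Q) :
    ∃ A : Formula T κ, A.Distinguishes P Q := by
  unfold NTS.LogEq at h
  push Not at h
  obtain ⟨A, h | h⟩ := h
  · exact ⟨A, h⟩
  · exact ⟨A.neg, valid_neg.2 h.1, fun hc => valid_neg.1 hc h.2⟩

/-- The support of a distinguishing formula can be cut down to that of the first state. -/
theorem Formula.exists_distinguishes_supp_subset [Countable 𝒩]
    (hsrt : ∀ a : 𝒩, {b | srt b = srt a}.Infinite) (hκ : ℵ₀ < κ) {P Q : State}
    (h : ¬ T.LogEq κ P Q) :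
    ∃ A : Formula T κ, A.Distinguishes P Q ∧ supp srt A ⊆ supp srt P := by
  obtain ⟨A, hA⟩ := exists_distinguishes h
  have hP := T.state_finSupp P
  -- The `G`-orbit of `A` is invariant under `G`, hence supported by `supp P`, although its members
  -- need not be.
  let G : Subgroup (NamePerm srt) := fixingSubgroup (NamePerm srt) (supp srt P)
  have hG : ∀ g : G, ∀ a ∈ supp srt P, g.1 • a = a := fun g a ha =>
    (mem_fixingSubgroup_iff _).1 g.2 a ha
  let f : G → Formula T κ := fun g => g.1 • A
  have hsup : MulAction.Supports (NamePerm srt) (supp srt P) (Set.range f) := by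
    intro π hπ
    have hπ' : π ∈ G := (mem_fixingSubgroup_iff _).2 fun a ha => hπ ha
    ext B
    rw [Set.mem_smul_set_iff_inv_smul_mem]
    constructor
    · rintro ⟨g, hg⟩
      refine ⟨⟨π, hπ'⟩ * g, ?_⟩
      have hg' : g.1 • A = π⁻¹ • B := hg
      change (π * g.1) • A = B
      rw [mul_smul, hg', smul_inv_smul]
    · rintro ⟨g, rfl⟩
      exact ⟨⟨π, hπ'⟩⁻¹ * g, mul_smul π⁻¹ g.1 A⟩
  have hb : Bounded (Set.range f) :=
    ⟨card_range_lt_of_countable hκ f, .of_supports hP.finite_supp hsup⟩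
  refine ⟨conj _ hb, ⟨?_, ?_⟩, supp_conj_subset hb hP.finite_supp hsup⟩
  · rw [valid_conj, Set.forall_mem_range]
    intro g
    have e : g.1 • P = P := hP.supports_supp hsrt g.1 (hG g)
    have h1 := (valid_smul g.1 P A).2 hA.1
    rwa [e] at h1
  · rw [valid_conj]
    intro hc
    apply hA.2
    have h1 := hc _ ⟨1, rfl⟩
    rwa [show f 1 = A from one_smul _ A] at h1

/-- A set of formulas is supported by any set of names that contains the supports of its elements. -/
theorem Formula.supports_of_supp_subset (hsrt : ∀ a : 𝒩, {b | srt b = srt a}.Infinite)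
    {s : Set (Formula T κ)} {N : Set 𝒩} (h : ∀ A ∈ s, supp srt A ⊆ N) :
    MulAction.Supports (NamePerm srt) N s :=
  supports_set_of_forall fun A hA π hπ =>
    A.finSupp.supports_supp hsrt π fun _ ha => hπ (h A hA ha)

theorem Formula.exists_isChoice [Countable 𝒩] (hsrt : ∀ a : 𝒩, {b | srt b = srt a}.Infinite)
    (hκ : ℵ₀ < κ) : ∃ B : State → State → Formula T κ, Formula.IsChoice B := by
  have h : ∀ P Q : State, ∃ A : Formula T κ, ¬ T.LogEq κ P Q →
      A.Distinguishes P Q ∧ supp srt A ⊆ supp srt P := by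
    intro P Q
    by_cases h : T.LogEq κ P Q
    · have hb : Bounded (∅ : Set (Formula T κ)) := by
        refine ⟨?_, ∅, fun π _ => Set.smul_set_empty⟩
        rw [Cardinal.mk_eq_zero]
        exact Cardinal.aleph0_pos.trans (Cardinal.aleph0_lt_lift.2 hκ)
      exact ⟨conj ∅ hb, fun hc => absurd h hc⟩
    · obtain ⟨A, hA⟩ := exists_distinguishes_supp_subset hsrt hκ h
      exact ⟨A, fun _ => hA⟩
  choose B hB using h
  exact ⟨B, hB⟩

/-! ### The Hennessy–Milner theorem -/

/-- Logical equivalence is a bisimulation. -/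
theorem NTS.isBisimulation_logEq [Countable 𝒩] (hsrt : ∀ a : 𝒩, {b | srt b = srt a}.Infinite)
    (hκ : ℵ₀ < κ) (hκState : Cardinal.lift.{w} #State < Cardinal.lift.{uS} κ) :
    T.IsBisimulation (T.LogEq κ) where
  symm P Q h A := (h A).symm
  static P Q h φ hφ := (h (Formula.pred φ)).1 hφ
  sim := by
    intro P Q h α P' hα hs
    by_contra hc
    push Not at hc
    obtain ⟨B, hB⟩ := Formula.exists_isChoice (T := T) hsrt hκ
    have hsup : ∀ A ∈ B P' '' {Q' | T.Step Q α Q'}, supp srt A ⊆ supp srt P' := by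
      rintro _ ⟨Q', hQ', rfl⟩
      exact (hB P' Q' (hc Q' hQ')).2
    have hP' := (T.state_finSupp P').finite_supp
    have hsup' := Formula.supports_of_supp_subset hsrt hsup
    have hb : Formula.Bounded (B P' '' {Q' | T.Step Q α Q'}) :=
      ⟨Formula.card_image_lt _ _ hκState, .of_supports hP' hsup'⟩
    let A := Formula.conj _ hb
    have hA : supp srt A ⊆ supp srt P' := Formula.supp_conj_subset hb hP' hsup'
    have hvA : A.Valid P' := by
      rw [Formula.valid_conj, Set.forall_mem_image]
      exact fun Q' hQ' => (hB P' Q' (hc Q' hQ')).1.1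
    -- The binders of `α` are fresh for `Q` but perhaps not for `P`, so they are renamed before
    -- validity at `P` is unfolded. Because `supp A ⊆ supp P'`, a single renaming is an
    -- alpha-conversion both of the formula and of the transition to `P'`.
    have hvP : (Formula.act α A).Valid P := by
      obtain ⟨π, h1, h2⟩ := T.exists_perm_bn_fresh hsrt α
        ((T.act_finSupp α).finite_supp.union hP') (T.state_finSupp P).finite_supp
      rw [Formula.act_eq hsrt α A π fun a ha => h1 a ⟨ha.1.imp_right fun h => hA h, ha.2⟩,
        Formula.valid_act hsrt h2]
      exact ⟨π • P', hs.smul_of_fixes hsrt π h1, (Formula.valid_smul π P' A).2 hvA⟩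
    obtain ⟨Q', hQ', hv⟩ := (Formula.valid_act hsrt hα).1 ((h _).1 hvP)
    exact (hB P' Q' (hc Q' hQ')).1.2 (Formula.valid_conj.1 hv _ ⟨Q', hQ', rfl⟩)

/-- Bisimilarity and logical equivalence coincide. -/
theorem NTS.bisimilar_iff_logEq [Countable 𝒩] (hsrt : ∀ a : 𝒩, {b | srt b = srt a}.Infinite)
    (hκ : ℵ₀ < κ) (hκState : Cardinal.lift.{w} #State < Cardinal.lift.{uS} κ) {P Q : State} :
    T.Bisimilar P Q ↔ T.LogEq κ P Q :=
  ⟨fun h A => ⟨A.valid_of_bisimilar hsrt P Q h, A.valid_of_bisimilar hsrt Q P h.symm⟩,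
    fun h => ⟨_, isBisimulation_logEq hsrt hκ hκState, h⟩⟩

/-! ### Making the distinguishing formulas equivariant -/

/-- The conjuncts of the equivariant distinguishing formula obtained from a choice `B`. -/
def Formula.orbit (B : State → State → Formula T κ) (P Q : State) : Set (Formula T κ) :=
  Set.range fun π : NamePerm srt => π⁻¹ • B (π • P) (π • Q)

/-- Reindexing by `π ↦ π * σ⁻¹`; nothing is assumed of `B`. -/
theorem Formula.smul_orbit (B : State → State → Formula T κ) (σ : NamePerm srt) (P Q : State) :
    σ • orbit B P Q = orbit B (σ • P) (σ • Q) := by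
  ext A
  rw [Set.mem_smul_set_iff_inv_smul_mem]
  constructor
  · rintro ⟨π, hπ⟩
    refine ⟨π * σ⁻¹, ?_⟩
    simp only [mul_smul, inv_smul_smul, mul_inv_rev, inv_inv] at hπ ⊢
    rw [hπ, smul_inv_smul]
  · rintro ⟨π, rfl⟩
    exact ⟨π * σ, by simp only [mul_smul, mul_inv_rev]⟩

/-- The formula chosen at `π • P` has support within that of `π • P`, and applying `π⁻¹` carries
this bound back to `supp P`. -/
theorem Formula.IsChoice.supp_subset_of_mem_orbit {B : State → State → Formula T κ}
    (hB : IsChoice B) {P Q : State} (h : ¬ T.LogEq κ P Q) :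
    ∀ A ∈ orbit B P Q, supp srt A ⊆ supp srt P := by
  rintro _ ⟨π, rfl⟩ a ha
  rw [mem_supp_smul, inv_inv] at ha
  have h1 := (hB _ _ (mt (NTS.LogEq.smul_iff π).1 h)).2 ha
  rwa [mem_supp_smul, inv_smul_smul] at h1

theorem Formula.IsChoice.bounded_orbit [Countable 𝒩]
    (hsrt : ∀ a : 𝒩, {b | srt b = srt a}.Infinite) (hκ : ℵ₀ < κ)
    {B : State → State → Formula T κ} (hB : IsChoice B) {P Q : State} (h : ¬ T.LogEq κ P Q) :
    Bounded (orbit B P Q) :=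
  ⟨card_range_lt_of_countable hκ _, .of_supports (T.state_finSupp P).finite_supp
    (supports_of_supp_subset hsrt (hB.supp_subset_of_mem_orbit h))⟩

/-- Validity at `P` is transported from `π • P` for each conjunct; the conjunct for `π = 1` is `B P
Q` itself, which fails at `Q`. -/
theorem Formula.IsChoice.distinguishes_conj_orbit {B : State → State → Formula T κ}
    (hB : IsChoice B) {P Q : State} (h : ¬ T.LogEq κ P Q) (hb : Bounded (orbit B P Q)) :
    (conj (orbit B P Q) hb).Distinguishes P Q := by
  constructor
  · rw [valid_conj]
    rintro _ ⟨π, rfl⟩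
    have h1 := (hB _ _ (mt (NTS.LogEq.smul_iff π).1 h)).1.1
    rwa [valid_smul_iff, inv_inv]
  · rw [valid_conj]
    intro hc
    have h1 := hc _ ⟨1, rfl⟩
    simp only [inv_one, one_smul] at h1
    exact (hB P Q h).1.2 h1

theorem Formula.conj_congr {s t : Set (Formula T κ)} (h : s = t) (hs : Bounded s)
    (ht : Bounded t) : conj s hs = conj t ht := by
  subst h
  rfl

/-! ### Characteristic formulas and definability of well-formed properties -/

/-- An equivariant choice of distinguishing formulas yields equivariant characteristic formulas,
and disjunctions of these define the well-formed properties. -/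
theorem Formula.IsChoice.exists_characteristic [Countable 𝒩]
    (hsrt : ∀ a : 𝒩, {b | srt b = srt a}.Infinite) (hκ : ℵ₀ < κ)
    (hκState : Cardinal.lift.{w} #State < Cardinal.lift.{uS} κ)
    {D : State → State → Formula T κ} (hD : IsChoice D)
    (hequiv : ∀ (π : NamePerm srt) (P Q : State), ¬ T.LogEq κ P Q →
      π • D P Q = D (π • P) (π • Q)) :
    ∃ Char : State → Formula T κ,
      (∀ P, (∃ h, Char P = conj {A | ∃ Q, ¬ T.LogEq κ P Q ∧ A = D P Q} h) ∧
        (Char P).IsCharacteristic P) ∧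
      (∀ (π : NamePerm srt) (P : State), π • Char P = Char (π • P)) ∧
      ∀ S : Set State, T.WellFormed S →
        ∃ h, ∀ P, (disj {A | ∃ P' ∈ S, A = Char P'} h).Valid P ↔ P ∈ S := by
  have hb : ∀ P : State, Bounded {A | ∃ Q, ¬ T.LogEq κ P Q ∧ A = D P Q} := by
    intro P
    refine ⟨?_, .of_supports (T.state_finSupp P).finite_supp (supports_of_supp_subset hsrt ?_)⟩
    · refine (Cardinal.mk_le_mk_of_subset ?_).trans_lt (card_range_lt (D P) hκState)
      rintro _ ⟨Q, _, rfl⟩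
      exact ⟨Q, rfl⟩
    · rintro _ ⟨Q, hQ, rfl⟩
      exact (hD P Q hQ).2
  have hchar : ∀ P, (conj _ (hb P)).IsCharacteristic P := by
    intro P Q
    rw [NTS.bisimilar_iff_logEq hsrt hκ hκState]
    constructor
    · intro h
      rw [← h, valid_conj]
      rintro _ ⟨Q', hQ', rfl⟩
      exact (hD P Q' hQ').1.1
    · intro h
      by_contra hc
      exact (hD P Q hc).1.2 (valid_conj.1 h _ ⟨Q, hc, rfl⟩)
  have hsmul : ∀ (π : NamePerm srt) (P : State),
      π • conj _ (hb P) = conj _ (hb (π • P)) := by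
    intro π P
    obtain ⟨hb', e⟩ := smul_conj π _ (hb P)
    rw [e]
    apply conj_congr
    ext A
    rw [Set.mem_smul_set_iff_inv_smul_mem]
    constructor
    · rintro ⟨Q, hQ, h⟩
      refine ⟨π • Q, mt (NTS.LogEq.smul_iff π).1 hQ, ?_⟩
      rw [← hequiv π P Q hQ, ← h, smul_inv_smul]
    · rintro ⟨Q, hQ, rfl⟩
      rw [← smul_inv_smul π Q, NTS.LogEq.smul_iff] at hQ
      refine ⟨π⁻¹ • Q, hQ, ?_⟩
      rw [inv_smul_eq_iff, hequiv π P _ hQ, smul_inv_smul]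
  refine ⟨fun P => conj _ (hb P), fun P => ⟨⟨hb P, rfl⟩, hchar P⟩, hsmul, ?_⟩
  rintro S ⟨⟨N, hN⟩, hS⟩
  -- The set `N` that supports `S` also supports the set of disjuncts: a permutation fixing `N` maps
  -- `S` onto itself, and `Char` is equivariant.
  refine ⟨⟨?_, N, ?_⟩, ?_⟩
  · refine (Cardinal.mk_le_mk_of_subset ?_).trans_lt
      (card_range_lt (fun P => conj _ (hb P)) hκState)
    rintro _ ⟨P, _, rfl⟩
    exact ⟨P, rfl⟩
  · intro π hπ
    have h1 : π • S = S := hN π hπ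
    ext A
    rw [Set.mem_smul_set_iff_inv_smul_mem]
    constructor
    · rintro ⟨P, hP, h⟩
      exact ⟨π • P, h1 ▸ Set.smul_mem_smul_set hP, (inv_smul_eq_iff.1 h).trans (hsmul π P)⟩
    · rintro ⟨P, hP, rfl⟩
      rw [← h1, Set.mem_smul_set_iff_inv_smul_mem] at hP
      refine ⟨π⁻¹ • P, hP, ?_⟩
      rw [inv_smul_eq_iff, hsmul, smul_inv_smul]
  · intro P
    refine valid_disj.trans ⟨?_, ?_⟩
    · rintro ⟨_, ⟨P', hP', rfl⟩, h⟩
      exact hS P' hP' P ((hchar P' P).2 h)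
    · intro hP
      exact ⟨_, ⟨P, hP, rfl⟩, (hchar P P).1 (.refl P)⟩

end Logic

end NomHML


/-! ### Expressive completeness -/

theorem mainTheorem3 {𝒩 : Type un} {Srt : Type us} [Countable 𝒩]
    [Infinite 𝒩] (srt : 𝒩 → Srt) (hsrt : ∀ a : 𝒩, {b | srt b = srt a}.Infinite)
    {State : Type uS} {Pred : Type uP} {Act : Type uA} [MulAction (NamePerm srt) State]
    [MulAction (NamePerm srt) Pred] [MulAction (NamePerm srt) Act]
    (T : NTS srt State Pred Act) (κ : Cardinal.{w}) (hκ : ℵ₀ < κ)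
    (hκState : Cardinal.lift.{w} #State < Cardinal.lift.{uS} κ) :
    (∀ S : Set State, T.WellFormed S → ∃ A : Formula T κ, ∀ P, A.Valid P ↔ P ∈ S) ∧
    (∃ B : State → State → Formula T κ, Formula.IsChoice B) ∧
    ∀ B : State → State → Formula T κ, Formula.IsChoice B →
      ∃ D : State → State → Formula T κ,
        (∀ P Q, ¬ T.LogEq κ P Q →
          (∃ h, D P Q =
            Formula.conj (Set.range fun π : NamePerm srt => π⁻¹ • B (π • P) (π • Q)) h) ∧
          (D P Q).Distinguishes P Q ∧ supp srt (D P Q) ⊆ supp srt P) ∧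
        (∀ (π : NamePerm srt) (P Q : State), ¬ T.LogEq κ P Q →
          π • D P Q = D (π • P) (π • Q)) ∧
        ∃ Char : State → Formula T κ,
          (∀ P, (∃ h, Char P = Formula.conj {A | ∃ Q, ¬ T.LogEq κ P Q ∧ A = D P Q} h) ∧
            (Char P).IsCharacteristic P) ∧
          (∀ (π : NamePerm srt) (P : State), π • Char P = Char (π • P)) ∧
          ∀ S : Set State, T.WellFormed S →
            ∃ h, ∀ P, (Formula.disj {A | ∃ P' ∈ S, A = Char P'} h).Valid P ↔ P ∈ S := by
  classical
  obtain ⟨B₀, hB₀⟩ := Formula.exists_isChoice (T := T) hsrt hκ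
  have main : ∀ B : State → State → Formula T κ, Formula.IsChoice B →
      ∃ D : State → State → Formula T κ,
        (∀ P Q, ¬ T.LogEq κ P Q →
          (∃ h, D P Q = Formula.conj (Formula.orbit B P Q) h) ∧
          (D P Q).Distinguishes P Q ∧ supp srt (D P Q) ⊆ supp srt P) ∧
        ∀ (π : NamePerm srt) (P Q : State), ¬ T.LogEq κ P Q →
          π • D P Q = D (π • P) (π • Q) := by
    intro B hB
    -- On logically equivalent pairs the orbit of `B` need not be finitely supported, so `D` takes
    -- an arbitrary value there; no later claim concerns it.
    let D : State → State → Formula T κ := fun P Q =>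
      if h : T.LogEq κ P Q then B P Q else Formula.conj _ (hB.bounded_orbit hsrt hκ h)
    have hD : ∀ P Q (h : ¬ T.LogEq κ P Q),
        D P Q = Formula.conj _ (hB.bounded_orbit hsrt hκ h) := fun P Q h => dif_neg h
    refine ⟨D, fun P Q h => ?_, fun π P Q h => ?_⟩
    · rw [hD P Q h]
      exact ⟨⟨_, rfl⟩, hB.distinguishes_conj_orbit h _,
        Formula.supp_conj_subset _ (T.state_finSupp P).finite_supp
          (Formula.supports_of_supp_subset hsrt (hB.supp_subset_of_mem_orbit h))⟩
    · rw [hD P Q h, hD _ _ (mt (NTS.LogEq.smul_iff π).1 h)]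
      obtain ⟨hb, e⟩ := Formula.smul_conj π _ (hB.bounded_orbit hsrt hκ h)
      rw [e]
      exact Formula.conj_congr (Formula.smul_orbit B π P Q) _ _
  refine ⟨fun S hS => ?_, ⟨B₀, hB₀⟩, fun B hB => ?_⟩
  · obtain ⟨D, hD, hequiv⟩ := main B₀ hB₀
    obtain ⟨Char, -, -, h⟩ := Formula.IsChoice.exists_characteristic hsrt hκ hκState
      (fun P Q h => (hD P Q h).2) hequiv
    obtain ⟨hb, h⟩ := h S hS
    exact ⟨_, h⟩
  · obtain ⟨D, hD, hequiv⟩ := main B hB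
    exact ⟨D, hD, hequiv, Formula.IsChoice.exists_characteristic hsrt hκ hκState
      (fun P Q h => (hD P Q h).2) hequiv⟩
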